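/- **Swap systems.** A *swap system* $(\mathcal D,\mathcal P)$ consists of a finite, weakly connected digraph $\mathcal D=(V,A)$ without loops and multiple arcs, with $|V|\ge 2$, in which every vertex has an incoming and an outgoing arc, and of a partial order $\preceq_v$ for each $v\in V$ on the set $\Omega_v$ of *outcomes* of $v$, that is of pairs $\omega=\langle\omega^{in}\mid\omega^{out}\rangle$ of a set $\omega^{in}$ of incoming and a set $\omega^{out}$ of outgoing arcs of $v$. Put $\mathrm{NoDeal}_v=\langle\emptyset\mid\emptyset\rangle$ and, for a subgraph $\mathcal H$ of $\mathcal D$, let $\mathrm{Deal}^{\mathcal H}_v$ be the pair of all incoming and all outgoing arcs of $v$ in $\mathcal H$. It is required that $\mathrm{NoDeal}_v\prec_v\mathrm{Deal}^{\mathcal D}_v$, and that $\omega_1\preceq_v\omega_2$ whenever $\omega_1^{in}\subseteq\omega_2^{in}$ and $\omega_2^{out}\subseteq\omega_1^{out}$. An outcome $\omega$ is *acceptable* if $\mathrm{NoDeal}_v\preceq_v\omega$. **Protocols.** The asset of an arc $(u,v)$ is initially with $u$. A *swap protocol* runs for a fixed finite number of synchronous rounds and prescribes the moves of each party as a function of what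 it has observed. In a round a party may hand an asset that it possesses to the other end of its arc; put the asset of an outgoing arc $(u,v)$ that it possesses into an escrow contract secured by hashed time-locks; present hashkeys to the contracts on its incoming arcs; and send private messages. A hashkey is a triple $(s,p,\sigma)$ with a secret $s$, a list of parties $p$ and the nested signature $\sigma$ of $s$ by the parties of $p$, made backwards along $p$. A hashed time-lock accepts hashkeys with prescribed hash of $s$ and prescribed list $p$ (possibly empty, or one of several), each up to a prescribed time-out. When all locks of the contract on $(u,v)$ are unlocked, the asset goes to $v$; when some lock has timed out, it goes back to $u$. Assets, contracts and presented hashkeys are public; the hashes of all secrets are published in advance. Cryptography is ideal: messages are symbolic terms, and only those terms can be used that can be derived from the known ones with one's own secrets and signing key. Parties that deviate may make any moves, pool all their knowledge, and react to the messages of the same round. The arc $(u,v)$ is *triggered* in an execution if its asset is with $v$ when the protocol completes (an asset still in escrow then goes back to $u$); the outcome of $v$ is the pair of the sets of its triggered incoming and its triggered outgoing arcs. Let $\mathbb P(v)$ be the outcome of $v$ when all parties follow $\mathbb P$. The protocol $\mathbb P$ is *atomic* if it is * *live*: $\mathrm{Deal}^{\mathcal D}_v\preceq_v\mathbb P(v)$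 for all $v$; * *safe*: every party that follows $\mathbb P$ ends in an acceptable outcome, whatever the other parties do; * a *strong Nash equilibrium*: for no set $C\subseteq V$ there is an execution in which all parties outside $C$ follow $\mathbb P$ and whose outcomes $\omega_v$ satisfy $\mathbb P(v)\preceq_v\omega_v$ for all $v\in C$ and $\omega_v\neq\mathbb P(v)$ for some $v\in C$. **Herlihy's protocol on $\mathcal G$.** In round $0$ every party puts the assets of its outgoing arcs in $\mathcal G$ in escrow. The contract on $(u,v)$ has one hashlock for each party $w$ in the connected component of $v$ in $\mathcal G$; it accepts the hashkeys $(s_w,p,\sigma)$ with $s_w$ the secret of $w$ and $p$ a simple path in $\mathcal G$ from $v$ to $w$, presented no later than in round $|p|$, where $|p|$ is the number of vertices of $p$. A party $v$ that finds the correct contracts on all its incoming arcs of $\mathcal G$ at the beginning of round $1$ presents on them the hashkey $(s_v,(v),\mathrm{sig}_v(s_v))$; from then on, whenever a valid hashkey $(s,p,\sigma)$ with $v\notin p$ has been presented on one of its outgoing arcs of $\mathcal G$, it presents $(s,vp,\mathrm{sig}_v(\sigma))$ on all its incoming arcs of $\mathcal G$ in the next round. The protocol completes after round $|V|$. **Theorem.**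 A subgraph $\mathcal H$ of $\mathcal D$ (with any vertex set) *dominates* a spanning subgraph $\mathcal G$ if $\mathrm{Deal}^{\mathcal G}_v\preceq_v\mathrm{Deal}^{\mathcal H}_v$ for all vertices $v$ of $\mathcal H$; it *strictly dominates* $\mathcal G$ if, in addition, $\mathrm{Deal}^{\mathcal G}_v\prec_v\mathrm{Deal}^{\mathcal H}_v$ for some vertex $v$ of $\mathcal H$. A swap system $(\mathcal D,\mathcal P)$ has an atomic protocol if and only if $\mathcal D$ has a spanning subgraph $\mathcal G$ such that * (c.1) every connected component of $\mathcal G$ is strongly connected, and $\mathcal G$ has no isolated vertices; * (c.2) $\mathcal G$ dominates $\mathcal D$; * (c.3) no subgraph $\mathcal H$ of $\mathcal D$ strictly dominates $\mathcal G$. Moreover, for every spanning subgraph $\mathcal G$ with these properties, Herlihy's protocol on $\mathcal G$ is atomic. -/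

import Mathlib

/-! # Swap systems, swap protocols with hashed time-locks, and the protocol of Herlihy -/

namespace CrossSwap

universe u

/-! ## Swap systems -/

/-- An outcome of party `v` in the swap digraph `D`: the acquired assets are listed by the
in-neighbours they come from, the traded assets by the out-neighbours they go to. -/
@[ext]
structure Outcome {V : Type u} (D : Digraph V) (v : V) where
  inn : Set V
  out : Set V
  inn_sub : ∀ x ∈ inn, D.Adj x v
  out_sub : ∀ x ∈ out, D.Adj v x

/-- The outcome of `v` when the triggered arcs are the arcs of `D` that satisfy `R`. -/
def outcomeOf {V : Type u} (D : Digraph V) (R : V → V → Prop) (v : V) : Outcome D v where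
  inn := {x | D.Adj x v ∧ R x v}
  out := {x | D.Adj v x ∧ R v x}
  inn_sub := fun _ h => h.1
  out_sub := fun _ h => h.1

/-- No transfer takes place. -/
def noDeal {V : Type u} (D : Digraph V) (v : V) : Outcome D v :=
  outcomeOf D (fun _ _ => False) v

/-- All transfers of `D` take place. -/
def deal {V : Type u} (D : Digraph V) (v : V) : Outcome D v :=
  outcomeOf D D.Adj v

/-- `u` and `v` are joined by a path that may use arcs in either direction. -/
def SameComponent {V : Type u} (R : V → V → Prop) (u v : V) : Prop :=
  Relation.ReflTransGen (fun a b => R a b ∨ R b a) u v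

/-- A swap system: a swap digraph and one preference poset per party.
`pref v ω ω'` says that party `v` finds `ω'` at least as good as `ω`. -/
structure SwapSystem (V : Type u) where
  D : Digraph V
  loopless : ∀ v, ¬ D.Adj v v
  two_parties : Nontrivial V
  connected : ∀ u v, SameComponent D.Adj u v
  exists_in : ∀ v, ∃ x, D.Adj x v
  exists_out : ∀ v, ∃ x, D.Adj v x
  pref : (v : V) → Outcome D v → Outcome D v → Prop
  pref_refl : ∀ v ω, pref v ω ω
  pref_trans : ∀ v ω₁ ω₂ ω₃, pref v ω₁ ω₂ → pref v ω₂ ω₃ → pref v ω₁ ω₃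
  pref_antisymm : ∀ v ω₁ ω₂, pref v ω₁ ω₂ → pref v ω₂ ω₁ → ω₁ = ω₂
  noDeal_lt_deal : ∀ v, pref v (noDeal D v) (deal D v) ∧ noDeal D v ≠ deal D v
  monotone : ∀ v (ω₁ ω₂ : Outcome D v), ω₁.inn ⊆ ω₂.inn → ω₂.out ⊆ ω₁.out → pref v ω₁ ω₂

/-- Strict preference: `ω'` is better than `ω` for `v`. -/
def SwapSystem.spref {V : Type u} (S : SwapSystem V) (v : V) (ω ω' : Outcome S.D v) : Prop :=
  S.pref v ω ω' ∧ ω ≠ ω'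

/-- Acceptable outcomes are those at least as good as no deal. -/
def SwapSystem.Acceptable {V : Type u} (S : SwapSystem V) (v : V) (ω : Outcome S.D v) : Prop :=
  S.pref v (noDeal S.D v) ω

/-- Outcome vectors of a set `C` of parties. -/
abbrev SwapSystem.OutcomeVec {V : Type u} (S : SwapSystem V) (C : Set V) : Type u :=
  (v : C) → Outcome S.D (v : V)

/-- `y` is better than `x` for the set `C`: coordinate-wise at least as good, and different. -/
def SwapSystem.vecLt {V : Type u} (S : SwapSystem V) (C : Set V) (x y : S.OutcomeVec C) : Prop :=
  (∀ v : C, S.pref v (x v) (y v)) ∧ x ≠ y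

/-! ## Subgraphs and domination -/

/-- A subgraph of a digraph, with its own vertex set. -/
structure Subdigraph {V : Type u} (D : Digraph V) where
  verts : Set V
  Adj : V → V → Prop
  adj_sub : ∀ x y, Adj x y → D.Adj x y
  tail_mem : ∀ x y, Adj x y → x ∈ verts
  head_mem : ∀ x y, Adj x y → y ∈ verts

/-- `D` as a subgraph of itself. -/
def Subdigraph.whole {V : Type u} (D : Digraph V) : Subdigraph D where
  verts := Set.univ
  Adj := D.Adj
  adj_sub := fun _ _ h => h
  tail_mem := fun _ _ _ => Set.mem_univ _
  head_mem := fun _ _ _ => Set.mem_univ _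

/-- The outcome of `v` in which exactly its arcs in `H` are triggered. -/
def Subdigraph.dealOf {V : Type u} {D : Digraph V} (H : Subdigraph D) (v : V) : Outcome D v :=
  outcomeOf D H.Adj v

def Subdigraph.IsSpanning {V : Type u} {D : Digraph V} (G : Subdigraph D) : Prop :=
  G.verts = Set.univ

/-- Every connected component is strongly connected. -/
def Subdigraph.PiecewiseStronglyConnected {V : Type u} {D : Digraph V}
    (G : Subdigraph D) : Prop :=
  ∀ x ∈ G.verts, ∀ y ∈ G.verts, SameComponent G.Adj x y → Relation.ReflTransGen G.Adj x y

def Subdigraph.NoIsolated {V : Type u} {D : Digraph V} (G : Subdigraph D) : Prop :=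
  ∀ x ∈ G.verts, ∃ y, G.Adj x y ∨ G.Adj y x

/-- `H` dominates `G`. -/
def SwapSystem.Dominates {V : Type u} (S : SwapSystem V) (H G : Subdigraph S.D) : Prop :=
  ∀ v ∈ H.verts, S.pref v (G.dealOf v) (H.dealOf v)

/-- `H` strictly dominates `G`. -/
def SwapSystem.StrictlyDominates {V : Type u} (S : SwapSystem V) (H G : Subdigraph S.D) : Prop :=
  S.Dominates H G ∧ ∃ v ∈ H.verts, S.spref v (G.dealOf v) (H.dealOf v)

/-- `G` is a spanning subgraph, every connected component of it is strongly connected and has more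
than one vertex, it dominates the whole digraph, and no subgraph strictly dominates it. -/
structure SwapSystem.GoodSpanning {V : Type u} (S : SwapSystem V) (G : Subdigraph S.D) : Prop where
  spanning : G.IsSpanning
  piecewise : G.PiecewiseStronglyConnected
  noIsolated : G.NoIsolated
  dominates : S.Dominates G (Subdigraph.whole S.D)
  notDominated : ∀ H : Subdigraph S.D, ¬ S.StrictlyDominates H G

/-! ## Symbolic cryptography -/

/-- Messages: public data, secrets (`nonce v n` is the `n`-th secret generated by `v`), hash
values, pairs and signatures. Hashing is injective and cannot be inverted. -/
inductive Term (V : Type u) : Type u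
  | data (n : ℕ) : Term V
  | nonce (v : V) (n : ℕ) : Term V
  | hash (x : Term V) : Term V
  | pair (x y : Term V) : Term V
  | sig (v : V) (x : Term V) : Term V

/-- The messages that the parties in `C` together can produce from the messages in `B`.
They know their own secrets and can sign in their own names only. The hashes of all secrets are
public: they have been distributed before the protocol starts. -/
inductive Derivable {V : Type u} (C : Set V) (B : Set (Term V)) : Term V → Prop
  | known (x : Term V) : x ∈ B → Derivable C B x
  | data (n : ℕ) : Derivable C B (Term.data n)
  | nonce (v : V) (n : ℕ) : v ∈ C → Derivable C B (Term.nonce v n)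
  | hashedSecret (v : V) (n : ℕ) : Derivable C B (Term.hash (Term.nonce v n))
  | hash (x : Term V) : Derivable C B x → Derivable C B (Term.hash x)
  | pair (x y : Term V) : Derivable C B x → Derivable C B y → Derivable C B (Term.pair x y)
  | fst (x y : Term V) : Derivable C B (Term.pair x y) → Derivable C B x
  | snd (x y : Term V) : Derivable C B (Term.pair x y) → Derivable C B y
  | sig (v : V) (x : Term V) : v ∈ C → Derivable C B x → Derivable C B (Term.sig v x)
  | content (v : V) (x : Term V) : Derivable C B (Term.sig v x) → Derivable C B x

/-- `sig(⋯ sig(x, last vertex of p) ⋯, first vertex of p)`: the signatures of the vertices of the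
path `p` on `x`, backwards along `p`. -/
def sigChain {V : Type u} (p : List V) (x : Term V) : Term V :=
  p.foldr Term.sig x

/-! ## Smart contracts with hashed time-locks -/

/-- A hashkey `(s, p, σ)`. -/
@[ext]
structure Hashkey (V : Type u) where
  secret : Term V
  path : List V
  signature : Term V

/-- One way to unlock a hashed time-lock: a hashkey for the hash value `hashValue` with path
`path`, presented no later than in round `deadline`. With the empty path this is a
plain hashed time-lock `(h, τ)`. -/
@[ext]
structure LockOption (V : Type u) where
  hashValue : Term V
  path : List V
  deadline : ℕ

/-- Presenting the hashkey `k` in round `t` satisfies the option `o`. -/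
def Hashkey.Opens {V : Type u} (k : Hashkey V) (o : LockOption V) (t : ℕ) : Prop :=
  Term.hash k.secret = o.hashValue ∧ k.path = o.path ∧
    k.signature = sigChain k.path k.secret ∧ t ≤ o.deadline

/-- A hashed time-lock is given by its options, any one of which unlocks it. -/
abbrev Lock (V : Type u) : Type u := Set (LockOption V)

/-- A contract is a collection of hashed time-locks, all of which have to be unlocked. -/
abbrev Contract (V : Type u) : Type u := Set (Lock V)

/-- `K` records the hashkeys presented so far, with the round of each presentation. -/
def Lock.Unlocked {V : Type u} (L : Lock V) (K : Set (ℕ × Hashkey V)) : Prop :=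
  ∃ x ∈ K, ∃ o ∈ L, x.2.Opens o x.1

/-- After round `t` the lock is still locked and can no longer be unlocked. -/
def Lock.TimedOut {V : Type u} (L : Lock V) (K : Set (ℕ × Hashkey V)) (t : ℕ) : Prop :=
  ¬ L.Unlocked K ∧ ∀ o ∈ L, o.deadline ≤ t

/-- Where the asset of an arc `(u, v)` is: with `u`, in an escrow secured by a contract (together
with the hashkeys presented by `v` so far), or with `v`. -/
inductive AssetState (V : Type u) : Type u
  | source : AssetState V
  | escrow (c : Contract V) (K : Set (ℕ × Hashkey V)) : AssetState V
  | target : AssetState V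

/-- What the party `u` does about the asset of an arc `(u, v)`. -/
inductive GiverAct (V : Type u) : Type u
  | idle : GiverAct V
  | transfer : GiverAct V
  | lock (c : Contract V) : GiverAct V

/-- The giver can act only while it possesses the asset. -/
def AssetState.giver {V : Type u} : GiverAct V → AssetState V → AssetState V
  | GiverAct.transfer, AssetState.source => AssetState.target
  | GiverAct.lock c, AssetState.source => AssetState.escrow c ∅
  | _, s => s

open Classical in
/-- In round `t` the receiver presents the hashkeys `keys`, or hands the asset back if it
possesses it. -/
noncomputable def AssetState.receiver {V : Type u} (t : ℕ) (keys : Set (Hashkey V)) (back : Prop) :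
    AssetState V → AssetState V
  | AssetState.source => AssetState.source
  | AssetState.escrow c K => AssetState.escrow c (K ∪ {x | x.1 = t ∧ x.2 ∈ keys})
  | AssetState.target => if back then AssetState.source else AssetState.target

open Classical in
/-- At the end of round `t` a contract releases the asset to the receiver if all its locks are
unlocked, and returns it to the giver if one of its locks has timed out. -/
noncomputable def AssetState.resolve {V : Type u} (t : ℕ) : AssetState V → AssetState V
  | AssetState.escrow c K =>
      if ∀ L ∈ c, Lock.Unlocked L K then AssetState.target
      else if ∃ L ∈ c, Lock.TimedOut L K t then AssetState.source
      else AssetState.escrow c K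
  | s => s

/-! ## Protocols and their executions -/

/-- What one party does in one round: `give w` concerns its arc to `w`; `handBack w` and
`present w` concern its arc from `w`; `send w` are private messages to `w`. -/
structure Move (V : Type u) where
  give : V → GiverAct V
  handBack : V → Prop
  present : V → Set (Hashkey V)
  send : V → Set (Term V)

def Move.idle (V : Type u) : Move V where
  give := fun _ => GiverAct.idle
  handBack := fun _ => False
  present := fun _ => ∅
  send := fun _ => ∅

open Classical in
/-- Keep the parts of a move that can be carried out with the knowledge `K`. -/
noncomputable def Move.restrict {V : Type u} (K : Set (Term V)) (m : Move V) : Move V where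
  give := fun w =>
    match m.give w with
    | GiverAct.lock c =>
        if ∀ L ∈ c, ∀ o ∈ L, o.hashValue ∈ K then GiverAct.lock c else GiverAct.idle
    | a => a
  handBack := m.handBack
  present := fun w => {k | k ∈ m.present w ∧ k.secret ∈ K ∧ k.signature ∈ K}
  send := fun w => {x | x ∈ m.send w ∧ x ∈ K}

/-- The situation at the beginning of round `time`: the state of each asset and the moves made
in the preceding round. -/
structure Snapshot (V : Type u) where
  time : ℕ
  asset : V → V → AssetState V
  moves : V → Move V

def Snapshot.start (V : Type u) : Snapshot V where
  time := 0
  asset := fun _ _ => AssetState.source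
  moves := fun _ => Move.idle V

open Classical in
/-- What party `v` observes: everything except the private messages between other parties. -/
noncomputable def Snapshot.view {V : Type u} (v : V) (g : Snapshot V) : Snapshot V where
  time := g.time
  asset := g.asset
  moves := fun x =>
    { g.moves x with
      send := fun w => if x = v ∨ w = v then (g.moves x).send w else ∅ }

/-- Histories list the snapshots, the latest one first. -/
def current {V : Type u} (h : List (Snapshot V)) : Snapshot V :=
  h.headD (Snapshot.start V)

/-- The messages that the parties in `C` have seen: all presented hashkeys and all hash values
in contracts, which are public, and the private messages sent by or to a member of `C`. -/
def seen {V : Type u} (C : Set V) (h : List (Snapshot V)) : Set (Term V) :=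
  {x | ∃ g ∈ h, ∃ y w,
    (∃ k ∈ (g.moves y).present w, x = k.secret ∨ x = k.signature) ∨
    (∃ c, (g.moves y).give w = GiverAct.lock c ∧ ∃ L ∈ c, ∃ o ∈ L, x = o.hashValue) ∨
    ((y ∈ C ∨ w ∈ C) ∧ x ∈ (g.moves y).send w)}

/-- The messages that the parties in `C`, pooling what they know, can produce. -/
def knowledge {V : Type u} (C : Set V) (h : List (Snapshot V)) : Set (Term V) :=
  {x | Derivable C (seen C h) x}

/-- A swap protocol: the number of rounds after which it completes, and for each party its moves
as a function of everything that it has observed so far. -/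
structure Protocol (V : Type u) where
  duration : ℕ
  prog : V → List (Snapshot V) → Move V

/-- The behaviour of deviating parties: any moves whatsoever (cut down to their knowledge below). -/
abbrev Deviation (V : Type u) : Type u := V → ℕ → Move V

/-- The move of a party that follows the protocol. -/
noncomputable def Protocol.honestMove {V : Type u} (P : Protocol V) (h : List (Snapshot V))
    (v : V) : Move V :=
  (P.prog v (h.map (Snapshot.view v))).restrict (knowledge {v} h)

open Classical in
/-- The moves in the round that follows the history `h`, when the parties in `C` deviate and
all others follow the protocol. The parties in `C` pool their knowledge, and
they can react already to what the others do in the same round. -/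
noncomputable def Protocol.movesOf {V : Type u} (P : Protocol V) (C : Set V) (dev : Deviation V)
    (h : List (Snapshot V)) (v : V) : Move V :=
  if v ∈ C then
    (dev v (current h).time).restrict (knowledge C
      ({ current h with
          moves := fun x => if x ∈ C then Move.idle V else P.honestMove h x } :: h))
  else P.honestMove h v

/-- One round. -/
noncomputable def nextSnapshot {V : Type u} (g : Snapshot V) (m : V → Move V) : Snapshot V where
  time := g.time + 1
  asset := fun x y =>
    ((g.asset x y).giver ((m x).give y) |>.receiver g.time ((m y).present x)
      ((m y).handBack x)).resolve g.time
  moves := m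

/-- The history of the first `t` rounds. -/
noncomputable def Protocol.history {V : Type u} (P : Protocol V) (C : Set V) (dev : Deviation V) :
    ℕ → List (Snapshot V)
  | 0 => [Snapshot.start V]
  | t + 1 =>
      nextSnapshot (current (P.history C dev t)) (P.movesOf C dev (P.history C dev t)) ::
        P.history C dev t

/-- The arc `(x, y)` is triggered: its asset is with `y` when the protocol completes.
(Assets in an escrow at that time go back to the giver.) -/
def Protocol.Triggered {V : Type u} (P : Protocol V) (C : Set V) (dev : Deviation V)
    (x y : V) : Prop :=
  (current (P.history C dev P.duration)).asset x y = AssetState.target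

/-- The outcome of `v` when the parties in `C` deviate and all others follow the protocol. -/
def Protocol.outcome {V : Type u} (P : Protocol V) (D : Digraph V) (C : Set V) (dev : Deviation V)
    (v : V) : Outcome D v :=
  outcomeOf D (P.Triggered C dev) v

/-- The outcome of `v` when all parties follow the protocol. -/
def Protocol.allFollow {V : Type u} (P : Protocol V) (D : Digraph V) (v : V) : Outcome D v :=
  P.outcome D ∅ (fun _ _ => Move.idle V) v

/-! ## Atomicity -/

def SwapSystem.IsLive {V : Type u} (S : SwapSystem V) (P : Protocol V) : Prop :=
  ∀ v, S.pref v (deal S.D v) (P.allFollow S.D v)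

/-- Whoever follows the protocol ends in an acceptable outcome, whatever the others do. -/
def SwapSystem.IsSafe {V : Type u} (S : SwapSystem V) (P : Protocol V) : Prop :=
  ∀ (C : Set V) (dev : Deviation V), ∀ v, v ∉ C → S.Acceptable v (P.outcome S.D C dev v)

def SwapSystem.IsUniform {V : Type u} (S : SwapSystem V) (P : Protocol V) : Prop :=
  S.IsLive P ∧ S.IsSafe P

/-- No coalition can improve its outcome vector by deviating. -/
def SwapSystem.IsStrongNash {V : Type u} (S : SwapSystem V) (P : Protocol V) : Prop :=
  ∀ (C : Set V) (dev : Deviation V),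
    ¬ S.vecLt C (fun v => P.allFollow S.D v) (fun v => P.outcome S.D C dev v)

def SwapSystem.IsAtomic {V : Type u} (S : SwapSystem V) (P : Protocol V) : Prop :=
  S.IsUniform P ∧ S.IsStrongNash P

/-! ## The protocol of Herlihy on the arcs `G`, run in each connected component -/

/-- `p` lists the vertices of a simple path from `v` to `w`. -/
def IsSimplePath {V : Type u} (G : V → V → Prop) (v w : V) (p : List V) : Prop :=
  p.head? = some v ∧ p.getLast? = some w ∧ p.IsChain G ∧ p.Nodup

/-- The hashlock of party `w` on an arc that ends in `v`: it is unlocked by the secret of `w`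
signed along a simple path from `v` to `w`, presented by the round that is
the number of vertices of the path. -/
def herlihyLock {V : Type u} (G : V → V → Prop) (v w : V) : Lock V :=
  {o | o.hashValue = Term.hash (Term.nonce w 0) ∧ IsSimplePath G v w o.path ∧
    o.deadline = o.path.length}

/-- The contract on an arc that ends in `v`: one hashlock for each party in the component. -/
def herlihyContract {V : Type u} (G : V → V → Prop) (v : V) : Contract V :=
  {L | ∃ w, SameComponent G v w ∧ L = herlihyLock G v w}

/-- Party `v` has found the correct contract on each of its incoming arcs in time, that is at
the beginning of round 1, and so has entered the phase of secret propagation. -/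
def HerlihyPhaseTwo {V : Type u} (G : V → V → Prop) (v : V) (h : List (Snapshot V)) : Prop :=
  ∃ g ∈ h, g.time = 1 ∧ ∀ x, G x v → ∃ K, g.asset x v = AssetState.escrow (herlihyContract G v) K

/-- The hashkey by which `v` reveals its own secret. -/
def ownKey {V : Type u} (v : V) : Hashkey V :=
  ⟨Term.nonce v 0, [v], Term.sig v (Term.nonce v 0)⟩

/-- The hashkey that `v` makes of a hashkey it has observed. -/
def extendKey {V : Type u} (v : V) (k : Hashkey V) : Hashkey V :=
  ⟨k.secret, v :: k.path, Term.sig v k.signature⟩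

/-- `k` is a hashkey that was presented in the preceding round on the outgoing arc
`(v, w)` and is valid for the contract on that arc. -/
def NewKeyOn {V : Type u} (G : V → V → Prop) (v w : V) (g : Snapshot V) (k : Hashkey V) : Prop :=
  G v w ∧ k ∈ (g.moves w).present v ∧
    ∃ L ∈ herlihyContract G w, ∃ o ∈ L, k.Opens o (g.time - 1)

open Classical in
/-- In round 0 each party puts each of its outgoing assets in escrow. If it then finds the correct
contract on all its incoming arcs, it presents its own hashkey on them, and from then on it extends
each new hashkey on an outgoing arc and presents the result on all its incoming arcs. -/
noncomputable def herlihy {V : Type u} (G : V → V → Prop) : Protocol V where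
  duration := Nat.card V + 1
  prog := fun v h =>
    { give := fun w =>
        if (current h).time = 0 ∧ G v w then GiverAct.lock (herlihyContract G w)
        else GiverAct.idle
      handBack := fun _ => False
      present := fun x =>
        {k | G x v ∧ HerlihyPhaseTwo G v h ∧
          (((current h).time = 1 ∧ k = ownKey v) ∨
            ∃ w k', NewKeyOn G v w (current h) k' ∧ v ∉ k'.path ∧ k = extendKey v k')}
      send := fun _ => ∅ }

end CrossSwap

/-!
# Which swap systems have an atomic protocol

*Necessity.* Given an atomic protocol, let `G` consist of the arcs that are triggered when all
parties follow it. Liveness says that `G` dominates `D`. If a subgraph `H` strictly dominated `G`,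
the coalition of its vertices could hand over the assets of `H` directly and do nothing else, which
contradicts the strong Nash property. Strong connectivity of the components is a consequence of
non-domination: if `(x, y)` is an arc of `G` and `y` does not reach `x`, then the subgraph induced
on the vertices that `y` does not reach loses outgoing arcs only, one of them at `x`, and so
strictly dominates `G` (`SwapSystem.IsAtomic.exists_goodSpanning`).

*Sufficiency.* Everything rests on one property of the protocol of Herlihy on `G`,
`triggered_of_triggered`: if some outgoing arc of a party `v` that follows it is triggered, then
this arc is in `G` and all incoming arcs of `v` in `G` are triggered. Indeed, all locks on an
outgoing arc have been opened. A hashkey whose path avoids `v` is extended by `v` in time. If its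
path passes through `v`, it contains a signature of `v`; signatures cannot be forged
(`signedWithin_of_mem_seen`), so `v` has already presented the hashkey for the rest of the path on
all its incoming arcs. Hence each lock on the incoming arcs is opened before it times out.

So a following party either loses nothing, or its outcome is at least as good as its outcome in `G`;
this gives safety. For the strong Nash property, take a profitable deviation of a coalition `C` and
drop all following parties that lose nothing. No triggered arc leaves a dropped party, so for the
others the remaining triggered arcs are at least as good as the outcome reached, and they form a
subgraph that strictly dominates `G`. Liveness holds because the hashkey for each simple path `p` is
presented in round `|p|` (`pathKey_present_of_all_follow`).
-/

namespace CrossSwap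

variable {V : Type*}

/-! ### Executions round by round -/

section Execution

variable (P : Protocol V) (C : Set V) (dev : Deviation V)

/-- The situation at the beginning of round `t`. -/
noncomputable def Protocol.snap (t : ℕ) : Snapshot V :=
  current (P.history C dev t)

/-- The moves that are made in round `t`. -/
noncomputable def Protocol.roundMoves (t : ℕ) : V → Move V :=
  P.movesOf C dev (P.history C dev t)

lemma Protocol.snap_time (t : ℕ) : (P.snap C dev t).time = t := by
  induction t with
  | zero => rfl
  | succ t ih =>
    change (P.snap C dev t).time + 1 = t + 1
    rw [ih]

lemma Protocol.mem_history {t : ℕ} {g : Snapshot V} :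
    g ∈ P.history C dev t ↔ ∃ s ≤ t, g = P.snap C dev s := by
  induction t with
  | zero =>
    constructor
    · intro h
      exact ⟨0, le_rfl, List.mem_singleton.1 h⟩
    · rintro ⟨s, hs, rfl⟩
      obtain rfl : s = 0 := by omega
      exact List.mem_singleton.2 rfl
  | succ t ih =>
    rw [Protocol.history, List.mem_cons, ih]
    constructor
    · rintro (h | ⟨s, hs, h⟩)
      · exact ⟨t + 1, le_rfl, h⟩
      · exact ⟨s, by omega, h⟩
    · rintro ⟨s, hs, h⟩
      rcases Nat.lt_or_ge t s with hlt | hle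
      · obtain rfl : s = t + 1 := by omega
        exact Or.inl h
      · exact Or.inr ⟨s, hle, h⟩

lemma Protocol.current_view_history (t : ℕ) (v : V) :
    current ((P.history C dev t).map (Snapshot.view v)) = (P.snap C dev t).view v := by
  cases t <;> rfl

lemma Protocol.asset_succ (t : ℕ) (x y : V) :
    (P.snap C dev (t + 1)).asset x y =
      ((((P.snap C dev t).asset x y).giver ((P.roundMoves C dev t x).give y)).receiver t
        ((P.roundMoves C dev t y).present x)
        ((P.roundMoves C dev t y).handBack x)).resolve t := by
  have h := P.snap_time C dev t
  change ((((P.snap C dev t).asset x y).giver ((P.roundMoves C dev t x).give y)).receiver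
    (P.snap C dev t).time ((P.roundMoves C dev t y).present x)
    ((P.roundMoves C dev t y).handBack x)).resolve (P.snap C dev t).time = _
  rw [h]

lemma Protocol.roundMoves_of_notMem {v : V} (hv : v ∉ C) (t : ℕ) :
    P.roundMoves C dev t v = P.honestMove (P.history C dev t) v :=
  if_neg hv

end Execution

/-! ### Knowledge and unforgeable signatures -/

/-- The terms that a move discloses. -/
def Move.terms (m : Move V) : Set (Term V) :=
  {x | ∃ w, (∃ k ∈ m.present w, x = k.secret ∨ x = k.signature) ∨
    (∃ c, m.give w = GiverAct.lock c ∧ ∃ L ∈ c, ∃ o ∈ L, x = o.hashValue) ∨ x ∈ m.send w}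

lemma Move.terms_restrict_subset (K : Set (Term V)) (m : Move V) : (m.restrict K).terms ⊆ K := by
  rintro x ⟨w, ⟨k, ⟨-, hs, hσ⟩, rfl | rfl⟩ | ⟨c, hc, L, hL, o, ho, rfl⟩ | hx⟩
  · exact hs
  · exact hσ
  · simp only [Move.restrict] at hc
    split at hc
    · split_ifs at hc with hK
      cases hc
      exact hK L hL o ho
    · rename_i hne
      exact absurd hc (hne c)
  · exact hx.2

lemma Move.terms_idle : (Move.idle V).terms = ∅ := by
  ext x
  simp [Move.terms, Move.idle]

lemma seen_mono {C C' : Set V} (h : C ⊆ C') (l : List (Snapshot V)) : seen C l ⊆ seen C' l := by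
  rintro x ⟨g, hg, y, w, h1 | h1 | ⟨h1, h2⟩⟩
  · exact ⟨g, hg, y, w, Or.inl h1⟩
  · exact ⟨g, hg, y, w, Or.inr (Or.inl h1)⟩
  · exact ⟨g, hg, y, w, Or.inr (Or.inr ⟨h1.imp (@h _) (@h _), h2⟩)⟩

lemma mem_seen_cons {C : Set V} {g : Snapshot V} {l : List (Snapshot V)} {x : Term V}
    (h : x ∈ seen C (g :: l)) : (∃ y, x ∈ (g.moves y).terms) ∨ x ∈ seen C l := by
  obtain ⟨g', hg', y, w, h⟩ := h
  rcases List.mem_cons.1 hg' with rfl | hg'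
  · exact Or.inl ⟨y, w, h.imp_right (Or.imp_right And.right)⟩
  · exact Or.inr ⟨g', hg', y, w, h⟩

lemma mem_seen_of_present {C : Set V} {l : List (Snapshot V)} {g : Snapshot V} (hg : g ∈ l)
    {y w : V} {k : Hashkey V} (hk : k ∈ (g.moves y).present w) :
    k.secret ∈ seen C l ∧ k.signature ∈ seen C l :=
  ⟨⟨g, hg, y, w, Or.inl ⟨k, hk, Or.inl rfl⟩⟩, ⟨g, hg, y, w, Or.inl ⟨k, hk, Or.inr rfl⟩⟩⟩

/-- All signatures of `v` that can be extracted from a term belong to `A`. What is under a hash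
cannot be extracted. -/
def SignedWithin (v : V) (A : Set (Term V)) : Term V → Prop
  | Term.data _ => True
  | Term.nonce _ _ => True
  | Term.hash _ => True
  | Term.pair x y => SignedWithin v A x ∧ SignedWithin v A y
  | Term.sig u x => (u = v → Term.sig u x ∈ A) ∧ SignedWithin v A x

lemma SignedWithin.mono {v : V} {A A' : Set (Term V)} (h : A ⊆ A') {x : Term V}
    (hx : SignedWithin v A x) : SignedWithin v A' x := by
  induction x with
  | data n => trivial
  | nonce u n => trivial
  | hash x _ => trivial
  | pair x y ihx ihy => exact ⟨ihx hx.1, ihy hx.2⟩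
  | sig u x ih => exact ⟨fun hu => h (hx.1 hu), ih hx.2⟩

/-- Signatures cannot be forged: without the signing key of `v`, no new signature of `v` can be
produced. -/
lemma Derivable.signedWithin {v : V} {A : Set (Term V)} {C : Set V} {B : Set (Term V)}
    (hv : v ∉ C) (hB : ∀ x ∈ B, SignedWithin v A x) {x : Term V} (hx : Derivable C B x) :
    SignedWithin v A x := by
  induction hx with
  | known x hx => exact hB x hx
  | data n => trivial
  | nonce u n hu => trivial
  | hashedSecret u n => trivial
  | hash x _ _ => trivial
  | pair x y _ _ ihx ihy => exact ⟨ihx, ihy⟩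
  | fst x y _ ih => exact ih.1
  | snd x y _ ih => exact ih.2
  | sig u x hu _ ih => exact ⟨fun h => absurd (h ▸ hu) hv, ih⟩
  | content u x _ ih => exact ih.2

/-- A chain of signatures contains the signature that `v` made when the chain reached `v`. -/
lemma SignedWithin.of_sigChain_append {v : V} {A : Set (Term V)} {q r : List V} {x : Term V}
    (h : SignedWithin v A (sigChain (q ++ v :: r) x)) : Term.sig v (sigChain r x) ∈ A := by
  induction q with
  | nil => exact h.1 rfl
  | cons a q ih => exact ih h.2

/-- A chain of signatures on a secret determines the signers, since a secret is not itself a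
signature. -/
lemma sigChain_nonce_injective {p q : List V} {u w : V} {m n : ℕ}
    (h : sigChain p (Term.nonce u m) = sigChain q (Term.nonce w n)) :
    p = q ∧ Term.nonce u m = Term.nonce w n := by
  induction p generalizing q with
  | nil =>
    cases q with
    | nil => exact ⟨rfl, h⟩
    | cons b q => exact Term.noConfusion (rfl) (heq_of_eq h)
  | cons a p ih =>
    cases q with
    | nil => exact Term.noConfusion (rfl) (heq_of_eq h)
    | cons b q =>
      injection h with h1 h2
      obtain ⟨rfl, h3⟩ := ih h2
      exact ⟨by rw [h1], h3⟩

/-! ### Simple paths -/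

/-- The part of a simple path from `v` on is a simple path that starts in `v`. -/
lemma IsSimplePath.suffix {G : V → V → Prop} {v w u : V} {q r : List V}
    (h : IsSimplePath G w u (q ++ v :: r)) : IsSimplePath G v u (v :: r) := by
  obtain ⟨-, h2, h3, h4⟩ := h
  refine ⟨rfl, ?_, h3.right_of_append, h4.of_append_right⟩
  rwa [List.getLast?_append_of_ne_nil _ (by simp)] at h2

lemma IsSimplePath.cons {G : V → V → Prop} {v w u : V} {p : List V} (h : IsSimplePath G w u p)
    (hvw : G v w) (hv : v ∉ p) : IsSimplePath G v u (v :: p) := by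
  obtain ⟨h1, h2, h3, h4⟩ := h
  cases p with
  | nil => simp at h1
  | cons a p =>
    obtain rfl : a = w := by simpa using h1
    refine ⟨rfl, ?_, List.isChain_cons_cons.2 ⟨hvw, h3⟩, List.nodup_cons.2 ⟨hv, h4⟩⟩
    rwa [List.getLast?_cons_cons]

lemma exists_isSimplePath {G : V → V → Prop} {v u : V} (h : Relation.ReflTransGen G v u) :
    ∃ p, IsSimplePath G v u p := by
  induction h using Relation.ReflTransGen.head_induction_on with
  | refl => exact ⟨[u], rfl, rfl, List.isChain_singleton _, List.nodup_singleton _⟩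
  | @head a c hvw _ ih =>
    obtain ⟨p, hp⟩ := ih
    by_cases hv : a ∈ p
    · obtain ⟨q, r, rfl⟩ := List.append_of_mem hv
      exact ⟨_, hp.suffix⟩
    · exact ⟨_, hp.cons hvw hv⟩

lemma IsSimplePath.sameComponent {G : V → V → Prop} {u : V} {p : List V} :
    ∀ {v : V}, IsSimplePath G v u p → SameComponent G v u := by
  induction p with
  | nil => intro v hp; simp [IsSimplePath] at hp
  | cons a r ih =>
    intro v hp
    obtain rfl : a = v := by simpa using hp.1
    cases r with
    | nil =>
      obtain rfl : a = u := by simpa using hp.2.1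
      exact Relation.ReflTransGen.refl
    | cons w r =>
      exact Relation.ReflTransGen.head (Or.inl (List.isChain_cons_cons.1 hp.2.2.1).1)
        (ih (IsSimplePath.suffix (q := [a]) hp))

lemma IsSimplePath.length_pos {G : V → V → Prop} {v u : V} {p : List V}
    (h : IsSimplePath G v u p) : 1 ≤ p.length := by
  cases p with
  | nil => simp [IsSimplePath] at h
  | cons a p => simp

lemma IsSimplePath.length_le [Finite V] {G : V → V → Prop} {v u : V} {p : List V}
    (h : IsSimplePath G v u p) : p.length ≤ Nat.card V := by
  have := Fintype.ofFinite V
  rw [Nat.card_eq_fintype_card]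
  exact h.2.2.2.length_le_card

/-! ### The moves of a party that follows the protocol of Herlihy -/

section Herlihy

variable (G : V → V → Prop) (C : Set V) (dev : Deviation V)

/-- Party `v` finds the correct contracts on all its incoming arcs at the beginning of round 1. -/
def FindsContracts (v : V) : Prop :=
  ∀ x, G x v →
    ∃ K, ((herlihy G).snap C dev 1).asset x v = AssetState.escrow (herlihyContract G v) K

/-- The hashkeys that a party `v` in the phase of secret propagation is to present in
round `t + 1`. -/
def PropagatesKey (v : V) (t : ℕ) (k : Hashkey V) : Prop :=
  (t = 0 ∧ k = ownKey v) ∨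
    ∃ w k', G v w ∧ k' ∈ ((herlihy G).roundMoves C dev t w).present v ∧
      (∃ L ∈ herlihyContract G w, ∃ o ∈ L, k'.Opens o t) ∧ v ∉ k'.path ∧ k = extendKey v k'

variable {G C dev}

lemma herlihyPhaseTwo_iff {v : V} {t : ℕ} :
    HerlihyPhaseTwo G v (((herlihy G).history C dev t).map (Snapshot.view v)) ↔
      1 ≤ t ∧ FindsContracts G C dev v := by
  constructor
  · rintro ⟨g, hg, h1, h2⟩
    obtain ⟨g', hg', rfl⟩ := List.mem_map.1 hg
    obtain ⟨s, hs, rfl⟩ := (Protocol.mem_history _ _ _).1 hg'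
    obtain rfl : s = 1 := ((herlihy G).snap_time C dev s).symm.trans h1
    exact ⟨hs, h2⟩
  · rintro ⟨h1, h2⟩
    exact ⟨_, List.mem_map.2 ⟨_, (Protocol.mem_history _ _ _).2 ⟨1, h1, rfl⟩, rfl⟩,
      (herlihy G).snap_time C dev 1, h2⟩

lemma newKeyOn_view_iff {v w : V} {t : ℕ} {k : Hashkey V} :
    NewKeyOn G v w (((herlihy G).snap C dev (t + 1)).view v) k ↔
      G v w ∧ k ∈ ((herlihy G).roundMoves C dev t w).present v ∧
        ∃ L ∈ herlihyContract G w, ∃ o ∈ L, k.Opens o t := by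
  have h : (((herlihy G).snap C dev (t + 1)).view v).time - 1 = t :=
    congrArg (· - 1) ((herlihy G).snap_time C dev (t + 1))
  unfold NewKeyOn
  rw [h]
  exact Iff.rfl

/-- Following the protocol is within the knowledge of a party, so restricting its moves to that
knowledge changes nothing. -/
lemma PropagatesKey.mem_knowledge {v : V} {t : ℕ} {k : Hashkey V}
    (hk : PropagatesKey G C dev v t k) :
    k.secret ∈ knowledge {v} ((herlihy G).history C dev (t + 1)) ∧
      k.signature ∈ knowledge {v} ((herlihy G).history C dev (t + 1)) := by
  rcases hk with ⟨-, rfl⟩ | ⟨w, k', -, hk', -, -, rfl⟩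
  · exact ⟨.nonce v 0 rfl, .sig v _ rfl (.nonce v 0 rfl)⟩
  · have h := mem_seen_of_present (C := {v}) (g := (herlihy G).snap C dev (t + 1))
      ((Protocol.mem_history _ _ _).2 ⟨t + 1, le_rfl, rfl⟩) hk'
    exact ⟨.known _ h.1, .sig v _ rfl (.known _ h.2)⟩

lemma herlihy_present_zero {v : V} (hv : v ∉ C) (x : V) :
    ((herlihy G).roundMoves C dev 0 v).present x = ∅ := by
  rw [Protocol.roundMoves_of_notMem _ _ _ hv]
  refine Set.eq_empty_of_forall_notMem fun k hk => ?_
  have := (herlihyPhaseTwo_iff.1 hk.1.2.1).1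
  omega

lemma herlihy_present_succ {v : V} (hv : v ∉ C) (t : ℕ) (x : V) (k : Hashkey V) :
    k ∈ ((herlihy G).roundMoves C dev (t + 1) v).present x ↔
      G x v ∧ FindsContracts G C dev v ∧ PropagatesKey G C dev v t k := by
  have htime : (current (((herlihy G).history C dev (t + 1)).map (Snapshot.view v))).time
      = t + 1 := by
    rw [Protocol.current_view_history]
    exact (herlihy G).snap_time C dev (t + 1)
  have hprop : (((current (((herlihy G).history C dev (t + 1)).map (Snapshot.view v))).time = 1 ∧
      k = ownKey v) ∨ ∃ w k', NewKeyOn G v w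
        (current (((herlihy G).history C dev (t + 1)).map (Snapshot.view v))) k' ∧
        v ∉ k'.path ∧ k = extendKey v k') ↔ PropagatesKey G C dev v t k := by
    rw [htime, Protocol.current_view_history]
    simp only [newKeyOn_view_iff, PropagatesKey, and_assoc, Nat.add_eq_right]
  rw [Protocol.roundMoves_of_notMem _ _ _ hv]
  constructor
  · rintro ⟨⟨h1, h2, h3⟩, -⟩
    exact ⟨h1, (herlihyPhaseTwo_iff.1 h2).2, hprop.1 h3⟩
  · rintro ⟨h1, h2, h3⟩
    exact ⟨⟨h1, herlihyPhaseTwo_iff.2 ⟨by omega, h2⟩, hprop.2 h3⟩, h3.mem_knowledge⟩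

open Classical in
lemma herlihy_give {v : V} (hv : v ∉ C) (t : ℕ) (w : V) :
    ((herlihy G).roundMoves C dev t v).give w =
      if t = 0 ∧ G v w then GiverAct.lock (herlihyContract G w) else GiverAct.idle := by
  have htime : (current (((herlihy G).history C dev t).map (Snapshot.view v))).time = t := by
    rw [Protocol.current_view_history]
    exact (herlihy G).snap_time C dev t
  have hK : ∀ L ∈ herlihyContract G w, ∀ o ∈ L,
      o.hashValue ∈ knowledge {v} ((herlihy G).history C dev t) := by
    rintro L ⟨u, -, rfl⟩ o ho
    rw [ho.1]
    exact .hashedSecret u 0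
  rw [Protocol.roundMoves_of_notMem _ _ _ hv]
  have hprog : ((herlihy G).prog v (((herlihy G).history C dev t).map (Snapshot.view v))).give w
      = if t = 0 ∧ G v w then GiverAct.lock (herlihyContract G w) else GiverAct.idle := by
    conv_rhs => rw [← htime]
    rfl
  simp only [Protocol.honestMove, Move.restrict, hprog]
  by_cases h : t = 0 ∧ G v w
  · simp only [if_pos h]
    exact if_pos hK
  · simp only [if_neg h]

lemma herlihy_handBack {v : V} (hv : v ∉ C) (t : ℕ) (w : V) :
    ((herlihy G).roundMoves C dev t v).handBack w = False := by
  rw [Protocol.roundMoves_of_notMem _ _ _ hv]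
  rfl

lemma herlihy_send {v : V} (hv : v ∉ C) (t : ℕ) (w : V) :
    ((herlihy G).roundMoves C dev t v).send w = ∅ := by
  rw [Protocol.roundMoves_of_notMem _ _ _ hv]
  exact Set.eq_empty_of_forall_notMem fun x hx => hx.1

/-! ### Signatures in an execution -/

variable (G C dev) in
/-- The signatures in the hashkeys that `v` presents before round `t`. -/
def publishedSignatures (v : V) (t : ℕ) : Set (Term V) :=
  {a | ∃ s < t, ∃ x, ∃ k ∈ ((herlihy G).roundMoves C dev s v).present x, a = k.signature}

lemma publishedSignatures_mono {v : V} {s t : ℕ} (h : s ≤ t) :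
    publishedSignatures G C dev v s ⊆ publishedSignatures G C dev v t := by
  rintro a ⟨r, hr, ha⟩
  exact ⟨r, by omega, ha⟩

/-- One round of the invariant `signedWithin_of_mem_seen`, for the moves of the parties that follow
the protocol. -/
lemma signedWithin_of_follows {v y : V} (hv : v ∉ C) (hy : y ∉ C) {t : ℕ}
    (ih : ∀ a ∈ seen Set.univ ((herlihy G).history C dev t),
      SignedWithin v (publishedSignatures G C dev v t) a) :
    ∀ a ∈ ((herlihy G).roundMoves C dev t y).terms,
      SignedWithin v (publishedSignatures G C dev v (t + 1)) a := by
  intro a ha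
  by_cases hyv : y = v
  · subst hyv
    obtain ⟨w, ⟨k, hk, ha⟩ | ⟨c, hc, L, hL, o, ho, rfl⟩ | ha⟩ := ha
    · cases t with
      | zero =>
        rw [herlihy_present_zero hy] at hk
        exact absurd hk (Set.notMem_empty k)
      | succ t =>
        have hsig : k.signature ∈ publishedSignatures G C dev y (t + 1 + 1) :=
          ⟨t + 1, by omega, w, k, hk, rfl⟩
        obtain ⟨-, -, hk'⟩ := (herlihy_present_succ hy t w k).1 hk
        rcases hk' with ⟨-, rfl⟩ | ⟨u, k', -, hk', -, -, rfl⟩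
        · rcases ha with rfl | rfl
          · trivial
          · exact ⟨fun _ => hsig, trivial⟩
        · have hm := mem_seen_of_present (C := Set.univ) (g := (herlihy G).snap C dev (t + 1))
            ((Protocol.mem_history _ _ _).2 ⟨t + 1, le_rfl, rfl⟩) hk'
          have h1 := (ih _ hm.1).mono (publishedSignatures_mono (Nat.le_succ _))
          have h2 := (ih _ hm.2).mono (publishedSignatures_mono (Nat.le_succ _))
          rcases ha with rfl | rfl
          · exact h1
          · exact ⟨fun _ => hsig, h2⟩
    · rw [herlihy_give hy] at hc
      split_ifs at hc
      cases hc
      obtain ⟨u, -, rfl⟩ := hL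
      rw [ho.1]
      trivial
    · rw [herlihy_send hy] at ha
      exact absurd ha (Set.notMem_empty a)
  · rw [Protocol.roundMoves_of_notMem _ _ _ hy] at ha
    have hd : Derivable {y} _ a := Move.terms_restrict_subset _ _ ha
    refine (hd.signedWithin (fun h => hyv h.symm) fun x hx => ?_).mono
      (publishedSignatures_mono (Nat.le_succ t))
    exact ih x (seen_mono (Set.subset_univ _) _ hx)

/-- Every signature of a party `v` that follows the protocol has been published by `v` itself in
one of its hashkeys. -/
lemma signedWithin_of_mem_seen {v : V} (hv : v ∉ C) (t : ℕ) :
    ∀ a ∈ seen Set.univ ((herlihy G).history C dev t),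
      SignedWithin v (publishedSignatures G C dev v t) a := by
  induction t with
  | zero =>
    intro a ha
    rcases mem_seen_cons ha with ⟨y, hy⟩ | ⟨g, hg, -⟩
    · rw [show ((Snapshot.start V).moves y).terms = ∅ from Move.terms_idle] at hy
      exact absurd hy (Set.notMem_empty a)
    · exact absurd hg List.not_mem_nil
  | succ t ih =>
    have hold : ∀ a ∈ seen Set.univ ((herlihy G).history C dev t),
        SignedWithin v (publishedSignatures G C dev v (t + 1)) a := fun a ha =>
      (ih a ha).mono (publishedSignatures_mono (Nat.le_succ t))
    intro a ha
    rcases mem_seen_cons ha with ⟨y, hy⟩ | ha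
    · change a ∈ ((herlihy G).roundMoves C dev t y).terms at hy
      by_cases hyC : y ∈ C
      · rw [Protocol.roundMoves, Protocol.movesOf, if_pos hyC] at hy
        have hd : Derivable C _ a := Move.terms_restrict_subset _ _ hy
        refine hd.signedWithin hv fun x hx => ?_
        rcases mem_seen_cons hx with ⟨z, hz⟩ | hx
        · by_cases hzC : z ∈ C
          · simp only [if_pos hzC, Move.terms_idle] at hz
            exact absurd hz (Set.notMem_empty x)
          · simp only [if_neg hzC] at hz
            rw [← Protocol.roundMoves_of_notMem _ _ _ hzC] at hz
            exact signedWithin_of_follows hv hzC ih x hz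
        · exact hold x (seen_mono (Set.subset_univ _) _ hx)
      · exact signedWithin_of_follows hv hyC ih a hy
    · exact hold a ha

/-! ### The assets of a party that follows the protocol -/

/-- The records of the hashkeys that `y` presents before round `t` on its arc from `x`. -/
def presented (P : Protocol V) (C : Set V) (dev : Deviation V) (x y : V) (t : ℕ) :
    Set (ℕ × Hashkey V) :=
  {z | z.1 < t ∧ z.2 ∈ (P.roundMoves C dev z.1 y).present x}

lemma Lock.Unlocked.mono {L : Lock V} {K K' : Set (ℕ × Hashkey V)} (h : K ⊆ K')
    (hL : L.Unlocked K) : L.Unlocked K' := by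
  obtain ⟨z, hz, o, ho⟩ := hL
  exact ⟨z, h hz, o, ho⟩

/-- The asset of an outgoing arc of a following party is only ever put in the prescribed escrow in
round 0, so that it gets to the receiver only when the receiver has opened all the locks. -/
lemma outgoing_asset {v : V} (hv : v ∉ C) (w : V) (t : ℕ) :
    ((herlihy G).snap C dev t).asset v w = AssetState.source ∨
    (G v w ∧ ∃ K ⊆ presented (herlihy G) C dev v w t,
      ((herlihy G).snap C dev t).asset v w = AssetState.escrow (herlihyContract G w) K) ∨
    (G v w ∧ (∀ L ∈ herlihyContract G w, L.Unlocked (presented (herlihy G) C dev v w t)) ∧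
      ((herlihy G).snap C dev t).asset v w = AssetState.target) := by
  have hmono : ∀ t, presented (herlihy G) C dev v w t ⊆ presented (herlihy G) C dev v w (t + 1) :=
    fun t z hz => ⟨Nat.lt_succ_of_lt hz.1, hz.2⟩
  -- The end of a round that finds the asset in escrow; also used when it has just been put there.
  have hescrow : ∀ t K, G v w → K ⊆ presented (herlihy G) C dev v w t →
      ∀ a, a = ((AssetState.escrow (herlihyContract G w) K).receiver t
        (((herlihy G).roundMoves C dev t w).present v)
        (((herlihy G).roundMoves C dev t w).handBack v)).resolve t →
      a = AssetState.source ∨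
      (G v w ∧ ∃ K ⊆ presented (herlihy G) C dev v w (t + 1),
        a = AssetState.escrow (herlihyContract G w) K) ∨
      (G v w ∧ (∀ L ∈ herlihyContract G w,
        L.Unlocked (presented (herlihy G) C dev v w (t + 1))) ∧ a = AssetState.target) := by
    rintro t K hG hK a rfl
    have hK' : K ∪ {z | z.1 = t ∧ z.2 ∈ ((herlihy G).roundMoves C dev t w).present v} ⊆
        presented (herlihy G) C dev v w (t + 1) := by
      rintro z (hz | ⟨rfl, hz⟩)
      · exact hmono t (hK hz)
      · exact ⟨Nat.lt_succ_self _, hz⟩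
    simp only [AssetState.receiver, AssetState.resolve]
    split_ifs with h1 h2
    · exact Or.inr (Or.inr ⟨hG, fun L hL => (h1 L hL).mono hK', rfl⟩)
    · exact Or.inl rfl
    · exact Or.inr (Or.inl ⟨hG, _, hK', rfl⟩)
  induction t with
  | zero => exact Or.inl rfl
  | succ t ih =>
    have hs := (herlihy G).asset_succ C dev t v w
    rw [herlihy_give hv] at hs
    rcases ih with h | ⟨hG, K, hK, h⟩ | ⟨hG, hL, h⟩
    · rw [h] at hs
      split_ifs at hs with h0
      · exact hescrow t ∅ h0.2 (Set.empty_subset _) _ hs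
      · exact Or.inl hs
    · refine hescrow t K hG hK _ ?_
      rw [h] at hs
      split_ifs at hs <;> exact hs
    · rw [h] at hs
      have hs' : ((herlihy G).snap C dev (t + 1)).asset v w =
          (AssetState.target.receiver t (((herlihy G).roundMoves C dev t w).present v)
            (((herlihy G).roundMoves C dev t w).handBack v)).resolve t := by
        split_ifs at hs <;> exact hs
      simp only [AssetState.receiver] at hs'
      split_ifs at hs'
      · exact Or.inl hs'
      · exact Or.inr (Or.inr ⟨hG, fun L hL' => (hL L hL').mono (hmono t), hs'⟩)

/-- A receiver that finds the correct contract and in time presents a hashkey for each of its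
locks gets the asset. The contract cannot return the asset early: a lock times out only when the
deadlines of all its options have passed. -/
lemma incoming_triggered_of_presents [Finite V] {x v : V} (hv : v ∉ C) {K₁ : Set (ℕ × Hashkey V)}
    (h1 : ((herlihy G).snap C dev 1).asset x v = AssetState.escrow (herlihyContract G v) K₁)
    (hkeys : ∀ u, SameComponent G v u → ∃ o ∈ herlihyLock G v u, ∃ s, 1 ≤ s ∧ s ≤ o.deadline ∧
      ∃ k ∈ ((herlihy G).roundMoves C dev s v).present x, k.Opens o s) :
    (herlihy G).Triggered C dev x v := by
  -- A contract with all presentations up to the last deadline of one of its locks has it unlocked.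
  have hunlock : ∀ L ∈ herlihyContract G v, ∀ t, (∀ o ∈ L, o.deadline ≤ t) →
      ∀ K, (∀ s k, 1 ≤ s → s ≤ t → k ∈ ((herlihy G).roundMoves C dev s v).present x →
        (s, k) ∈ K) → L.Unlocked K := by
    rintro L ⟨u, hu, rfl⟩ t ht K hK
    obtain ⟨o, ho, s, hs1, hs, k, hk, hko⟩ := hkeys u hu
    exact ⟨(s, k), hK s k hs1 (hs.trans (ht o ho)) hk, o, ho, hko⟩
  have hstep : ∀ t, ((herlihy G).snap C dev t).asset x v = AssetState.target →
      ((herlihy G).snap C dev (t + 1)).asset x v = AssetState.target := by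
    intro t h
    rw [Protocol.asset_succ, h, herlihy_handBack hv]
    cases ((herlihy G).roundMoves C dev t x).give v <;>
      simp [AssetState.giver, AssetState.receiver, AssetState.resolve]
  have hstep' : ∀ t K, ((herlihy G).snap C dev t).asset x v =
        AssetState.escrow (herlihyContract G v) K →
      ((herlihy G).snap C dev (t + 1)).asset x v =
        (AssetState.escrow (herlihyContract G v)
          (K ∪ {z | z.1 = t ∧ z.2 ∈ ((herlihy G).roundMoves C dev t v).present x})).resolve t := by
    intro t K h
    rw [Protocol.asset_succ, h]
    cases ((herlihy G).roundMoves C dev t x).give v <;> rfl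
  have hcover : ∀ t (K : Set (ℕ × Hashkey V)),
      (∀ s k, 1 ≤ s → s < t → k ∈ ((herlihy G).roundMoves C dev s v).present x → (s, k) ∈ K) →
      ∀ s k, 1 ≤ s → s ≤ t → k ∈ ((herlihy G).roundMoves C dev s v).present x →
        (s, k) ∈ K ∪ {z | z.1 = t ∧ z.2 ∈ ((herlihy G).roundMoves C dev t v).present x} := by
    intro t K hK s k hs1 hst hk
    rcases hst.lt_or_eq with h | rfl
    · exact Or.inl (hK s k hs1 h hk)
    · exact Or.inr ⟨rfl, hk⟩
  have hinv : ∀ t, 1 ≤ t → ((herlihy G).snap C dev t).asset x v = AssetState.target ∨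
      ∃ K, ((herlihy G).snap C dev t).asset x v = AssetState.escrow (herlihyContract G v) K ∧
        ∀ s k, 1 ≤ s → s < t → k ∈ ((herlihy G).roundMoves C dev s v).present x → (s, k) ∈ K := by
    intro t ht
    induction t, ht using Nat.le_induction with
    | base => exact Or.inr ⟨K₁, h1, fun s k hs1 hs _ => absurd hs (by omega)⟩
    | succ t ht ih =>
      rcases ih with h | ⟨K, h, hK⟩
      · exact Or.inl (hstep t h)
      · have hs := hstep' t K h
        simp only [AssetState.resolve] at hs
        split_ifs at hs with h2 h3
        · exact Or.inl hs
        · obtain ⟨L, hL, hno, hdl⟩ := h3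
          exact absurd (hunlock L hL t hdl _ (hcover t K hK)) hno
        · exact Or.inr ⟨_, hs, fun s k hs1 hst hk => hcover t K hK s k hs1 (by omega) hk⟩
  have : Nonempty V := ⟨v⟩
  have hcard : 1 ≤ Nat.card V := Nat.card_pos
  change ((herlihy G).snap C dev (Nat.card V + 1)).asset x v = AssetState.target
  rcases hinv _ hcard with h | ⟨K, h, hK⟩
  · exact hstep _ h
  -- Simple paths have at most `|V|` vertices, so by the end of round `|V|` all deadlines are over.
  · rw [hstep' _ K h, AssetState.resolve, if_pos]
    intro L hL
    refine hunlock L hL (Nat.card V) ?_ _ (hcover _ K hK)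
    obtain ⟨u, -, rfl⟩ := hL
    intro o ho
    rw [ho.2.2]
    exact ho.2.1.length_le

/-! ### Safety: a triggered outgoing arc forces all incoming arcs -/

/-- The hashkey for the secret of `u` with path `p`. -/
def pathKey (u : V) (p : List V) : Hashkey V :=
  ⟨Term.nonce u 0, p, sigChain p (Term.nonce u 0)⟩

/-- A published signature of `v` on a chain over a secret can come only from the hashkey with that
path, and `v` presents hashkeys on all its incoming arcs at once and before their deadlines. -/
lemma exists_present_of_published {v u : V} (hv : v ∉ C) {r : List V} {t : ℕ}
    (h : Term.sig v (sigChain r (Term.nonce u 0)) ∈ publishedSignatures G C dev v t) :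
    FindsContracts G C dev v ∧ ∃ s, 1 ≤ s ∧ s ≤ (v :: r).length ∧
      ∀ x, G x v → pathKey u (v :: r) ∈ ((herlihy G).roundMoves C dev s v).present x := by
  obtain ⟨s, -, x, k, hk, hsig⟩ := h
  cases s with
  | zero =>
    rw [herlihy_present_zero hv] at hk
    exact absurd hk (Set.notMem_empty k)
  | succ s =>
    obtain ⟨-, hf, hp⟩ := (herlihy_present_succ hv s x k).1 hk
    suffices hkey : k = pathKey u (v :: r) ∧ s ≤ r.length by
      obtain ⟨rfl, hs⟩ := hkey
      exact ⟨hf, s + 1, by omega, Nat.succ_le_succ hs, fun y hy =>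
        (herlihy_present_succ hv s y _).2 ⟨hy, hf, hp⟩⟩
    rcases hp with ⟨rfl, rfl⟩ | ⟨w, k', -, -, ⟨L, ⟨u', -, rfl⟩, o, ho, hko⟩, -, rfl⟩
    · injection hsig with _ h2
      obtain ⟨rfl, h3⟩ := sigChain_nonce_injective (q := []) h2
      injection h3 with h4
      subst h4
      exact ⟨rfl, Nat.zero_le _⟩
    · obtain ⟨hh, hpath, hσ, hdl⟩ := hko
      rw [ho.1] at hh
      injection hh with hsec
      injection hsig with _ h2
      rw [hσ, hsec] at h2
      obtain ⟨rfl, h3⟩ := sigChain_nonce_injective h2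
      rw [ho.2.2, ← hpath] at hdl
      refine ⟨?_, hdl⟩
      rw [← h3] at hsec
      ext1
      · exact hsec
      · rfl
      · change Term.sig v k'.signature = Term.sig v _
        rw [hσ, hsec]
        rfl

/-- The lock of `v` on the triggered arc was opened with a signature of `v`, so `v` has found the
correct contracts. The hashkey that opened the lock of another party `u` either does not pass
through `v`, and then `v` extends it, or contains a signature of `v`, and then `v` has presented
the hashkey for the remaining part of the path before. -/
lemma triggered_of_triggered [Finite V] {v w : V} (hv : v ∉ C)
    (hvw : (herlihy G).Triggered C dev v w) :
    G v w ∧ ∀ x, G x v → (herlihy G).Triggered C dev x v := by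
  change ((herlihy G).snap C dev (Nat.card V + 1)).asset v w = AssetState.target at hvw
  rcases outgoing_asset hv w (Nat.card V + 1) with h | ⟨-, K, -, h⟩ | ⟨hG, hL, -⟩
  · rw [h] at hvw
    cases hvw
  · rw [h] at hvw
    cases hvw
  refine ⟨hG, ?_⟩
  -- For each lock of the contract on `(v, w)`, the hashkey that opened it.
  have hopen : ∀ u, SameComponent G v u → ∃ p s, IsSimplePath G w u p ∧ s ≤ p.length ∧
      s < Nat.card V + 1 ∧ pathKey u p ∈ ((herlihy G).roundMoves C dev s w).present v := by
    intro u hu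
    have hwu : SameComponent G w u := Relation.ReflTransGen.head (Or.inr hG) hu
    obtain ⟨⟨s, k⟩, ⟨hs, hk⟩, o, ho, hh, hpath, hσ, hdl⟩ := hL _ ⟨u, hwu, rfl⟩
    rw [ho.1] at hh
    injection hh with hsec
    have hdl' : s ≤ o.path.length := ho.2.2 ▸ hdl
    refine ⟨o.path, s, ho.2.1, hdl', hs, ?_⟩
    have : k = pathKey u o.path := by
      ext1
      · exact hsec
      · exact hpath
      · change k.signature = sigChain o.path _
        rw [hσ, hsec, hpath]
    exact this ▸ hk
  -- If `v` lies on the path of a hashkey, then it has signed the remaining part of that path.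
  have hthrough : ∀ u p s, pathKey u p ∈ ((herlihy G).roundMoves C dev s w).present v →
      IsSimplePath G w u p → v ∈ p → FindsContracts G C dev v ∧
        ∃ r s', IsSimplePath G v u (v :: r) ∧
        1 ≤ s' ∧ s' ≤ (v :: r).length ∧
        ∀ x, G x v → pathKey u (v :: r) ∈ ((herlihy G).roundMoves C dev s' v).present x := by
    intro u p s hk hp hvp
    obtain ⟨q, r, rfl⟩ := List.append_of_mem hvp
    have hm := mem_seen_of_present (C := Set.univ) (g := (herlihy G).snap C dev (s + 1))
      ((Protocol.mem_history _ _ _).2 ⟨s + 1, le_rfl, rfl⟩) hk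
    obtain ⟨hf, s', h1, h2, h3⟩ := exists_present_of_published hv
      (signedWithin_of_mem_seen hv (s + 1) _ hm.2).of_sigChain_append
    exact ⟨hf, r, s', hp.suffix, h1, h2, h3⟩
  -- Every path to `v` passes through `v`, so the lock of `v` needs a signature of `v`.
  have hfinds : FindsContracts G C dev v := by
    obtain ⟨p, s, hp, -, -, hk⟩ := hopen v Relation.ReflTransGen.refl
    exact (hthrough v p s hk hp (List.mem_of_getLast? hp.2.1)).1
  intro x hx
  obtain ⟨K₁, hK₁⟩ := hfinds x hx
  refine incoming_triggered_of_presents hv hK₁ fun u hu => ?_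
  obtain ⟨p, s, hp, hsp, -, hk⟩ := hopen u hu
  by_cases hvp : v ∈ p
  · obtain ⟨-, r, s', hr, h1, h2, h3⟩ := hthrough u p s hk hp hvp
    exact ⟨⟨_, v :: r, _⟩, ⟨rfl, hr, rfl⟩, s', h1, h2, _, h3 x hx, rfl, rfl, rfl, h2⟩
  · refine ⟨⟨_, v :: p, _⟩, ⟨rfl, hp.cons hG hvp, rfl⟩, s + 1, by omega, Nat.succ_le_succ hsp,
      pathKey u (v :: p), (herlihy_present_succ hv s x _).2 ⟨hx, hfinds, Or.inr
        ⟨w, pathKey u p, hG, hk, ?_, hvp, rfl⟩⟩, rfl, rfl, rfl, Nat.succ_le_succ hsp⟩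
    exact ⟨_, ⟨u, Relation.ReflTransGen.head (Or.inr hG) hu, rfl⟩, ⟨_, p, _⟩, ⟨rfl, hp, rfl⟩,
      rfl, rfl, rfl, hsp⟩

/-! ### Liveness -/

/-- A contract survives round 0 because each of its locks can be opened along some simple path,
whose deadline is at least 1: without strong connectivity a lock might have no options at all. -/
lemma findsContracts_of_all_follow {dev : Deviation V}
    (hsc : ∀ x y, SameComponent G x y → Relation.ReflTransGen G x y) (v : V) :
    FindsContracts G ∅ dev v := by
  intro x hx
  refine ⟨∅, ?_⟩
  rw [Protocol.asset_succ, herlihy_give (Set.notMem_empty x), if_pos ⟨rfl, hx⟩,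
    herlihy_present_zero (Set.notMem_empty v)]
  have hno : ∀ L : Lock V, ¬ L.Unlocked ∅ := fun L ⟨z, hz, _⟩ => hz
  change (AssetState.escrow (herlihyContract G v) (∅ ∪ {z | z.1 = 0 ∧ z.2 ∈ ∅})).resolve 0 = _
  have hempty : (∅ ∪ {z | z.1 = 0 ∧ z.2 ∈ (∅ : Set (Hashkey V))} : Set (ℕ × Hashkey V)) = ∅ := by
    simp
  rw [hempty, AssetState.resolve, if_neg, if_neg]
  · rintro ⟨L, ⟨u, hu, rfl⟩, -, hdl⟩
    obtain ⟨p, hp⟩ := exists_isSimplePath (hsc v u hu)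
    have h0 : p.length ≤ 0 := hdl ⟨_, p, p.length⟩ ⟨rfl, hp, rfl⟩
    have := hp.length_pos
    omega
  · intro h
    exact hno _ (h _ ⟨v, Relation.ReflTransGen.refl, rfl⟩)

/-- If all parties follow the protocol, then every simple path `p` yields a hashkey that is
presented in round `|p|`. -/
lemma pathKey_present_of_all_follow {dev : Deviation V}
    (hsc : ∀ x y, SameComponent G x y → Relation.ReflTransGen G x y) {p : List V} :
    ∀ {v u : V}, IsSimplePath G v u p → ∀ x, G x v →
      pathKey u p ∈ ((herlihy G).roundMoves ∅ dev p.length v).present x := by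
  induction p with
  | nil => intro v u hp; simp [IsSimplePath] at hp
  | cons a r ih =>
    intro v u hp x hx
    obtain rfl : a = v := by simpa using hp.1
    refine (herlihy_present_succ (Set.notMem_empty a) _ _ _).2
      ⟨hx, findsContracts_of_all_follow hsc a, ?_⟩
    cases r with
    | nil =>
      obtain rfl : a = u := by simpa using hp.2.1
      exact Or.inl ⟨rfl, rfl⟩
    | cons w r =>
      have hr : IsSimplePath G w u (w :: r) := IsSimplePath.suffix (q := [a]) hp
      have haw : G a w := (List.isChain_cons_cons.1 hp.2.2.1).1
      refine Or.inr ⟨w, pathKey u (w :: r), haw, ih hr a haw, ?_,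
        (List.nodup_cons.1 hp.2.2.2).1, rfl⟩
      exact ⟨_, ⟨u, hr.sameComponent, rfl⟩, ⟨_, w :: r, _⟩, ⟨rfl, hr, rfl⟩, rfl, rfl, rfl, le_rfl⟩

lemma triggered_of_all_follow [Finite V] {dev : Deviation V}
    (hsc : ∀ x y, SameComponent G x y → Relation.ReflTransGen G x y) {x v : V} (hx : G x v) :
    (herlihy G).Triggered ∅ dev x v := by
  obtain ⟨K₁, hK₁⟩ := findsContracts_of_all_follow (dev := dev) hsc v x hx
  refine incoming_triggered_of_presents (Set.notMem_empty v) hK₁ fun u hu => ?_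
  obtain ⟨p, hp⟩ := exists_isSimplePath (hsc v u hu)
  exact ⟨⟨_, p, p.length⟩, ⟨rfl, hp, rfl⟩, p.length, hp.length_pos, le_rfl, _,
    pathKey_present_of_all_follow hsc hp x hx, rfl, rfl, rfl, le_rfl⟩

end Herlihy

/-! ### Atomicity of the protocol of Herlihy -/

section Atomic

variable {S : SwapSystem V} {G : Subdigraph S.D}

lemma SwapSystem.GoodSpanning.sameComponent (hG : S.GoodSpanning G) (x y : V)
    (h : SameComponent G.Adj x y) : Relation.ReflTransGen G.Adj x y :=
  hG.piecewise x (hG.spanning ▸ Set.mem_univ x) y (hG.spanning ▸ Set.mem_univ y) h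

lemma SwapSystem.GoodSpanning.pref_deal (hG : S.GoodSpanning G) (v : V) :
    S.pref v (deal S.D v) (G.dealOf v) :=
  hG.dominates v (hG.spanning ▸ Set.mem_univ v)

lemma SwapSystem.GoodSpanning.herlihy_allFollow [Finite V] (hG : S.GoodSpanning G) (v : V) :
    (herlihy G.Adj).allFollow S.D v = G.dealOf v := by
  have h : ∀ x y, (herlihy G.Adj).Triggered ∅ (fun _ _ => Move.idle V) x y ↔ G.Adj x y :=
    fun x y => ⟨fun h => (triggered_of_triggered (Set.notMem_empty x) h).1,
      fun h => triggered_of_all_follow hG.sameComponent h⟩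
  ext x
  · exact and_congr_right fun _ => h x v
  · exact and_congr_right fun _ => h v x

/-- A following party that loses an asset gets all its incoming arcs of `G`, and gives away at most
its outgoing ones. -/
lemma pref_outcome_of_triggered [Finite V] {C : Set V} {dev : Deviation V} {v w : V} (hv : v ∉ C)
    (hvw : (herlihy G.Adj).Triggered C dev v w) :
    S.pref v (G.dealOf v) ((herlihy G.Adj).outcome S.D C dev v) :=
  S.monotone v _ _ (fun x hx => ⟨hx.1, (triggered_of_triggered hv hvw).2 x hx.2⟩)
    fun _ hx => ⟨hx.1, (triggered_of_triggered hv hx.2).1⟩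

lemma SwapSystem.GoodSpanning.isSafe [Finite V] (hG : S.GoodSpanning G) :
    S.IsSafe (herlihy G.Adj) := by
  intro C dev v hv
  by_cases h : ∃ w, (herlihy G.Adj).Triggered C dev v w
  · obtain ⟨w, hw⟩ := h
    exact S.pref_trans v _ _ _ (S.noDeal_lt_deal v).1
      (S.pref_trans v _ _ _ (hG.pref_deal v) (pref_outcome_of_triggered hv hw))
  · exact S.monotone v _ _ (fun _ hx => hx.2.elim) fun x hx => absurd ⟨x, hx.2⟩ h

/-- After a profitable deviation, the triggered arcs between the deviating parties and those
following parties that have a triggered outgoing arc strictly dominate `G`. -/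
lemma SwapSystem.GoodSpanning.isStrongNash [Finite V] (hG : S.GoodSpanning G) :
    S.IsStrongNash (herlihy G.Adj) := by
  rintro C dev ⟨hle, hne⟩
  let T := (herlihy G.Adj).Triggered C dev
  let H : Subdigraph S.D :=
    { verts := {v | v ∈ C ∨ ∃ w, T v w}
      Adj := fun x y => S.D.Adj x y ∧ T x y ∧ (y ∈ C ∨ ∃ w, T y w)
      adj_sub := fun _ _ h => h.1
      tail_mem := fun _ y h => Or.inr ⟨y, h.2.1⟩
      head_mem := fun _ _ h => h.2.2 }
  have hout : ∀ v ∈ H.verts, S.pref v ((herlihy G.Adj).outcome S.D C dev v) (H.dealOf v) :=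
    fun v hv => S.monotone v _ _ (fun x hx => ⟨hx.1, hx.1, hx.2, hv⟩) fun x hx => ⟨hx.1, hx.2.2.1⟩
  have hleC : ∀ v ∈ C, S.pref v (G.dealOf v) ((herlihy G.Adj).outcome S.D C dev v) :=
    fun v hv => hG.herlihy_allFollow v ▸ hle ⟨v, hv⟩
  refine hG.notDominated H ⟨fun v hv => ?_, ?_⟩
  · refine S.pref_trans v _ _ _ ?_ (hout v hv)
    by_cases hvC : v ∈ C
    · exact hleC v hvC
    · obtain ⟨w, hw⟩ := hv.resolve_left hvC
      exact pref_outcome_of_triggered hvC hw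
  · obtain ⟨⟨v, hv⟩, hvne⟩ := Function.ne_iff.1 hne
    have hvH : v ∈ H.verts := Or.inl hv
    refine ⟨v, hvH, S.pref_trans v _ _ _ (hleC v hv) (hout v hvH), fun heq => hvne ?_⟩
    change (herlihy G.Adj).allFollow S.D v = (herlihy G.Adj).outcome S.D C dev v
    rw [hG.herlihy_allFollow]
    exact S.pref_antisymm v _ _ (hleC v hv) (heq ▸ hout v hvH)

lemma SwapSystem.GoodSpanning.isAtomic [Finite V] (hG : S.GoodSpanning G) :
    S.IsAtomic (herlihy G.Adj) := by
  refine ⟨⟨fun v => ?_, hG.isSafe⟩, hG.isStrongNash⟩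
  rw [hG.herlihy_allFollow]
  exact hG.pref_deal v

end Atomic

/-! ### The subgraph of an atomic protocol -/

section Necessity

variable {S : SwapSystem V}

/-- A connected component that is not strongly connected has a set of vertices that arcs leave but
do not enter, and the subgraph on such a set is better for its vertices. -/
lemma SwapSystem.piecewiseStronglyConnected_of_not_strictlyDominates {G : Subdigraph S.D}
    (hdom : ∀ H, ¬ S.StrictlyDominates H G) : G.PiecewiseStronglyConnected := by
  have hback : ∀ x y, G.Adj x y → Relation.ReflTransGen G.Adj y x := by
    intro x y hxy
    by_contra hyx
    let H : Subdigraph S.D :=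
      { verts := {v | ¬ Relation.ReflTransGen G.Adj y v}
        Adj := fun a b => G.Adj a b ∧ ¬ Relation.ReflTransGen G.Adj y b
        adj_sub := fun a b h => G.adj_sub a b h.1
        tail_mem := fun _ _ h h' => h.2 (h'.tail h.1)
        head_mem := fun _ _ h => h.2 }
    have hpref : S.Dominates H G := fun v hv =>
      S.monotone v _ _ (fun a ha => ⟨ha.1, ha.2, hv⟩) fun a ha => ⟨ha.1, ha.2.1⟩
    refine hdom H ⟨hpref, x, hyx, hpref x hyx, fun heq => ?_⟩
    have hy : y ∈ (G.dealOf x).out := ⟨G.adj_sub x y hxy, hxy⟩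
    rw [heq] at hy
    exact hy.2.2 Relation.ReflTransGen.refl
  intro x _ y hy h
  clear hy
  induction h with
  | refl => exact Relation.ReflTransGen.refl
  | tail _ h ih => exact ih.trans (h.elim Relation.ReflTransGen.single (hback _ _))

/-- The deviation in which each party hands over its assets of the arcs of `R` directly, and
nothing else. -/
noncomputable def directTransfer (R : V → V → Prop) : Deviation V := fun x _ =>
  { Move.idle V with
    give := open Classical in
      fun y => if R x y then GiverAct.transfer else GiverAct.idle }

/-- Among parties in `C` the arcs of `R` and only these are triggered, and no other asset leaves a
party of `C`. -/
lemma Protocol.asset_directTransfer (P : Protocol V) {C : Set V} {R : V → V → Prop} {x y : V}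
    (hx : x ∈ C) :
    (R x y → y ∈ C → ∀ t, (P.snap C (directTransfer R) (t + 1)).asset x y = AssetState.target) ∧
    (¬ R x y → ∀ t, (P.snap C (directTransfer R) t).asset x y = AssetState.source) := by
  have hgive : ∀ t, (P.roundMoves C (directTransfer R) t x).give y =
      open Classical in if R x y then GiverAct.transfer else GiverAct.idle := by
    intro t
    rw [Protocol.roundMoves, Protocol.movesOf, if_pos hx]
    by_cases h : R x y <;> simp [Move.restrict, directTransfer, h]
  constructor
  · intro hR hy t
    have hback : ∀ t, (P.roundMoves C (directTransfer R) t y).handBack x = False := by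
      intro t
      rw [Protocol.roundMoves, Protocol.movesOf, if_pos hy]
      rfl
    induction t with
    | zero =>
      rw [Protocol.asset_succ, hgive, if_pos hR, hback]
      exact congrArg _ (if_neg not_false)
    | succ t ih =>
      rw [Protocol.asset_succ, ih, hgive, if_pos hR, hback]
      exact congrArg _ (if_neg not_false)
  · intro hR t
    induction t with
    | zero => rfl
    | succ t ih =>
      rw [Protocol.asset_succ, ih, hgive, if_neg hR]
      rfl

/-- The arcs triggered when all parties follow an atomic protocol form the required subgraph. If `H`
strictly dominated it, then the vertices of `H` would gain by transferring the assets of `H`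
directly; arcs that enter `H` from outside can only improve their outcomes. -/
lemma SwapSystem.IsAtomic.exists_goodSpanning {P : Protocol V} (hP : S.IsAtomic P) :
    ∃ G : Subdigraph S.D, S.GoodSpanning G := by
  obtain ⟨⟨hlive, -⟩, hnash⟩ := hP
  let T := P.Triggered ∅ (fun _ _ => Move.idle V)
  let G : Subdigraph S.D :=
    { verts := Set.univ
      Adj := fun x y => S.D.Adj x y ∧ T x y
      adj_sub := fun _ _ h => h.1
      tail_mem := fun _ _ _ => Set.mem_univ _
      head_mem := fun _ _ _ => Set.mem_univ _ }
  have hdeal : ∀ v, P.allFollow S.D v = G.dealOf v := by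
    intro v
    ext x
    · exact ⟨fun h => ⟨h.1, h⟩, fun h => h.2⟩
    · exact ⟨fun h => ⟨h.1, h⟩, fun h => h.2⟩
  have hiso : G.NoIsolated := by
    intro v _
    by_contra hno
    push Not at hno
    have h0 : G.dealOf v = noDeal S.D v := by
      ext x
      · exact ⟨fun h => absurd h.2 (hno x).2, fun h => h.2.elim⟩
      · exact ⟨fun h => absurd h.2 (hno x).1, fun h => h.2.elim⟩
    have h1 := hlive v
    rw [hdeal, h0] at h1
    exact (S.noDeal_lt_deal v).2 (S.pref_antisymm v _ _ (S.noDeal_lt_deal v).1 h1)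
  -- The deviation needs one round; without any round nothing is triggered.
  have hdur : P.duration ≠ 0 := by
    intro hdur
    have hnot : ∀ x y, ¬ T x y := by
      intro x y h
      simp only [T, Protocol.Triggered, hdur] at h
      cases h
    obtain ⟨v, -⟩ := S.two_parties
    obtain ⟨y, h | h⟩ := hiso v (Set.mem_univ v)
    · exact hnot _ _ h.2
    · exact hnot _ _ h.2
  obtain ⟨d, hd⟩ := Nat.exists_eq_succ_of_ne_zero hdur
  have hdom : ∀ H, ¬ S.StrictlyDominates H G := by
    rintro H ⟨hHG, v, hv, hlt⟩
    have htrig : ∀ x y, H.Adj x y → P.Triggered H.verts (directTransfer H.Adj) x y := by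
      intro x y h
      have := (P.asset_directTransfer (R := H.Adj) (y := y) (H.tail_mem x y h)).1 h
        (H.head_mem x y h) d
      rwa [← Nat.succ_eq_add_one, ← hd] at this
    have hback : ∀ x ∈ H.verts, ∀ y, P.Triggered H.verts (directTransfer H.Adj) x y →
        H.Adj x y := by
      intro x hx y h
      by_contra hno
      have h' := (P.asset_directTransfer (y := y) hx).2 hno P.duration
      have h2 := h'.symm.trans h
      cases h2
    have hout : ∀ x ∈ H.verts,
        S.pref x (H.dealOf x) (P.outcome S.D H.verts (directTransfer H.Adj) x) := fun x hx =>
      S.monotone x _ _ (fun y hy => ⟨hy.1, htrig y x hy.2⟩) fun y hy => ⟨hy.1, hback x hx y hy.2⟩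
    refine hnash H.verts (directTransfer H.Adj) ⟨fun x => ?_, fun heq => hlt.2 ?_⟩
    · change S.pref x (P.allFollow S.D x) _
      rw [hdeal]
      exact S.pref_trans _ _ _ _ (hHG x x.2) (hout x x.2)
    · have hv' : P.allFollow S.D v = P.outcome S.D H.verts (directTransfer H.Adj) v :=
        congrFun heq ⟨v, hv⟩
      rw [hdeal] at hv'
      exact S.pref_antisymm v _ _ hlt.1 (hv' ▸ hout v hv)
  exact ⟨G, rfl, S.piecewiseStronglyConnected_of_not_strictlyDominates hdom, hiso,
    fun v _ => hdeal v ▸ hlive v, hdom⟩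

end Necessity

end CrossSwap

theorem mainTheorem1 {V : Type*} [Finite V] (S : CrossSwap.SwapSystem V) :
    ((∃ P : CrossSwap.Protocol V, S.IsAtomic P) ↔
      ∃ G : CrossSwap.Subdigraph S.D, S.GoodSpanning G) ∧
    ∀ G : CrossSwap.Subdigraph S.D, S.GoodSpanning G → S.IsAtomic (CrossSwap.herlihy G.Adj) :=
  ⟨⟨fun ⟨_, hP⟩ => hP.exists_goodSpanning, fun ⟨_, hG⟩ => ⟨_, hG.isAtomic⟩⟩,
    fun _ hG => hG.isAtomic⟩
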